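/- Let $E$ be an infinite-dimensional real Banach space that is polyhedral, i.e. every finite-dimensional section of its closed unit ball $B_E$ is the convex hull of finitely many points. For $f\in E^*$ with $\|f\|=1$ put $H_f=f^{-1}(1)$ and $S_f=H_f\cap B_E$, and let $\mathrm{int}(S_f)$ be the interior of $S_f$ relative to $H_f$. Sets $S_f$ with $\mathrm{int}(S_f)\neq\emptyset$ are called true faces of $B_E$, and the minimal boundary of $E$ is $\mathcal B_0=\{f\in E^*:\|f\|=1,\ S_f\text{ is a true face of }B_E\}$. Let $\mathcal B_0$ be represented as the disjoint union of two families of pairwise distinct functionals $\{f_w^+\}_{w\in I}$ and $\{f_w^-\}_{w\in I}$ with $f_w^+=-f_w^-$ for all $w\in I$, and write $S_w^\pm=S_{f_w^\pm}$. Let $\Gamma=\mathrm{card}(\mathcal B_0)$. Then $\Gamma=\mathrm{dens}(E)$, the least cardinality of a norm-dense subset of $E$, and for every $\mathcal C\subset I$ with $\mathrm{card}(\mathcal C)<\Gamma$ the following hold. 1. $\displaystyle B_E=\overline{\mathrm{conv}}\Bigl(\bigcup_{w\in I\setminus\mathcal C}(S_w^+\cup S_w^-)\Bigr)$. 2. For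 each $z\in B_E$ and each $\theta>0$ there exist a finite nonempty set $A\subset I\setminus\mathcal C$ and a finite nonempty set $G\subset\bigcup_{w\in A}\bigl(\mathrm{int}(S_w^+)\cup\mathrm{int}(S_w^-)\bigr)$ such that $z\in\mathrm{conv}(G)+\theta B_E$ and such that, for each $w\in A$, both $G\cap\mathrm{int}(S_w^+)$ and $G\cap\mathrm{int}(S_w^-)$ are singletons. -/

import Mathlib

open scoped Pointwise

universe u v

namespace PolyhedralSpace

/-- The density character of a topological space: the least cardinality of a dense subset. -/
noncomputable def dens (X : Type u) [TopologicalSpace X] : Cardinal.{u} :=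
  sInf {c | ∃ D : Set X, Dense D ∧ Cardinal.mk D = c}

/-- The relative topological interior `int_H F` of `F` in `H`, as a subset of the ambient space. -/
def interiorIn {X : Type u} [TopologicalSpace X] (H F : Set X) : Set X :=
  ((↑) : H → X) '' interior (((↑) : H → X) ⁻¹' F)

variable {E : Type u} [NormedAddCommGroup E] [NormedSpace ℝ E]

/-- A polytope: a closed, convex, bounded set all of whose finite-dimensional (affine) sections
are convex hulls of finitely many points. -/
def IsPolytope (P : Set E) : Prop :=
  IsClosed P ∧ Convex ℝ P ∧ Bornology.IsBounded P ∧
    ∀ L : AffineSubspace ℝ E, FiniteDimensional ℝ L.direction →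
      ∃ t : Set E, t.Finite ∧ P ∩ (L : Set E) = convexHull ℝ t

variable (E) in
/-- The space `E` is polyhedral if its closed unit ball is a polytope. -/
def IsPolyhedral : Prop := IsPolytope (Metric.closedBall (0 : E) 1)

/-- The hyperplane `f⁻¹(1)`. -/
def hyperplane (f : StrongDual ℝ E) : Set E := {x | f x = 1}

/-- The set `f⁻¹(1) ∩ B_E`. -/
def face (f : StrongDual ℝ E) : Set E := hyperplane f ∩ Metric.closedBall (0 : E) 1

/-- The interior of `f⁻¹(1) ∩ B_E` relative to the hyperplane `f⁻¹(1)`. -/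
def faceInterior (f : StrongDual ℝ E) : Set E := interiorIn (hyperplane f) (face f)

/-- `F` is a true face of `B_E`: `F = f⁻¹(1) ∩ B_E` for some norm-one functional `f`, and `F` has
nonempty interior relative to `f⁻¹(1)`. -/
def IsTrueFace (F : Set E) : Prop :=
  ∃ f : StrongDual ℝ E, ‖f‖ = 1 ∧ F = face f ∧ (faceInterior f).Nonempty

variable (E) in
/-- The minimal boundary `B₀` of a polyhedral space: all norm-one functionals that cut out a true
face of the unit ball. -/
def minimalBoundary : Set (StrongDual ℝ E) := {f | ‖f‖ = 1 ∧ IsTrueFace (face f)}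

end PolyhedralSpace

open PolyhedralSpace

namespace PolyhedralSpace

open Set Filter Topology

/-! ### Convexity along half-lines, radial affinity of a polyhedral norm, linear points -/

section Basic
variable {E : Type u} [NormedAddCommGroup E] [NormedSpace ℝ E]

/-! Polyhedrality enters only through `RadiallyAffine`, which passes to every subspace. Interiors of
true faces are, up to scaling, the points near which the norm agrees with a single functional
(`IsLinearPoint`). Baire category produces such points in separable spaces, and separable reduction
then produces them in general. A further Baire argument shows that their functionals norm every
vector, so the minimal boundary is a boundary (`exists_linearPoint_norming`).

The core is `mem_closure_span_of_norming`: if functionals `B` norm every unit vector in a slice `{h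
> a}` that meets the open ball, then `B` and `h` span a dense subspace of the dual. For countably
many functionals in one hyperplane, slightly inflated constraints `c n * φ n ≤ 1` cut out a set
inside the open ball near each point of which only finitely many constraints matter. An approximate
Ekeland maximum of `g` on this set must lie close to the span of those finitely many functionals.

The whole sphere as slice gives `dens E ≤ Γ`; the other inequality holds because distinct boundary
functionals have disjoint open sets of linear points. If the hull of the faces outside `C` missed a
point of the ball, a separating `h` would give a slice normed by functionals indexed by `C` alone,
so `dens E` would be too small, or `E` finite-dimensional. For the last claim, a convex combination
is regrouped to one vector per face, and each vector is pushed into the interior of its face. -/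

theorem mul_norm_add_smul_le (x v : E) {t s : ℝ} (ht : 0 ≤ t) (hts : t ≤ s) :
    s * ‖x + t • v‖ ≤ (s - t) * ‖x‖ + t * ‖x + s • v‖ := by
  have hs : 0 ≤ s := ht.trans hts
  have key : s • (x + t • v) = (s - t) • x + t • (x + s • v) := by module
  calc s * ‖x + t • v‖ = ‖s • (x + t • v)‖ := by rw [norm_smul, Real.norm_of_nonneg hs]
    _ ≤ ‖(s - t) • x‖ + ‖t • (x + s • v)‖ := by rw [key]; exact norm_add_le _ _
    _ = _ := by
      rw [norm_smul, norm_smul, Real.norm_of_nonneg ht, Real.norm_of_nonneg (sub_nonneg.2 hts)]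

/-- The convex function `‖·‖ - f` is nonnegative and vanishes at both endpoints, hence in between.
-/
theorem norm_eq_apply_of_between {f : StrongDual ℝ E} (hf : ∀ y, f y ≤ ‖y‖) {x v : E} {t s : ℝ}
    (hs : 0 < s) (ht : 0 ≤ t) (hts : t ≤ s) (h0 : ‖x‖ = f x) (h1 : ‖x + s • v‖ = f (x + s • v)) :
    ‖x + t • v‖ = f (x + t • v) := by
  refine le_antisymm ?_ (hf _)
  have h := mul_norm_add_smul_le x v ht hts
  rw [h0, h1] at h
  simp only [map_add, map_smul, smul_eq_mul] at h ⊢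
  exact le_of_mul_le_mul_left (by linarith) hs

variable (E) in
/-- The norm is affine near the starting point of every half-line. -/
def RadiallyAffine : Prop :=
  ∀ x v : E, ∃ s δ : ℝ, 0 < δ ∧ ∀ t, 0 ≤ t → t ≤ δ → ‖x + t • v‖ = ‖x‖ + t * s

theorem RadiallyAffine.submodule (h : RadiallyAffine E) (X : Submodule ℝ E) : RadiallyAffine X :=
  fun x v => by
    obtain ⟨s, δ, hδ, H⟩ := h x v
    exact ⟨s, δ, hδ, fun t h0 h1 => by simpa using H t h0 h1⟩

/-- The radial slope bounds the norm from below along the whole half-line. -/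
theorem RadiallyAffine.exists_slope (h : RadiallyAffine E) (x v : E) :
    ∃ s δ : ℝ, 0 < δ ∧ (∀ t, 0 ≤ t → t ≤ δ → ‖x + t • v‖ = ‖x‖ + t * s) ∧
      ∀ t, 0 ≤ t → ‖x‖ + t * s ≤ ‖x + t • v‖ := by
  obtain ⟨s, δ, hδ, H⟩ := h x v
  refine ⟨s, δ, hδ, H, fun t ht => ?_⟩
  rcases le_total t δ with h1 | h1
  · exact (H t ht h1).ge
  · have := mul_norm_add_smul_le x v hδ.le h1
    rw [H δ hδ.le le_rfl] at this
    exact le_of_mul_le_mul_left (by linarith) hδ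

/-- Since `f ≤ 1` on `t`, a combination at which `f` reaches `1` puts weight only on points where `f
= 1`. So the face exposed by `f` is determined by the subset of `t` it contains. -/
theorem mem_convexHull_apply_eq_one {t : Set E} (ht : t.Finite) {f g : StrongDual ℝ E}
    (hf : ∀ i ∈ t, f i ≤ 1) (hfg : ∀ i ∈ t, f i = 1 → g i = 1) {x : E}
    (hx : x ∈ convexHull ℝ t) (hfx : f x = 1) : g x = 1 := by
  lift t to Finset E using ht
  obtain ⟨w, hw0, hw1, rfl⟩ := Finset.mem_convexHull'.1 hx
  simp only [map_sum, map_smul, smul_eq_mul] at hfx ⊢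
  have hz : ∀ i ∈ t, w i * (1 - f i) = 0 := by
    refine (Finset.sum_eq_zero_iff_of_nonneg fun i hi => ?_).1 ?_
    · exact mul_nonneg (hw0 i hi) (sub_nonneg.2 (hf i hi))
    · simp only [mul_sub, mul_one, Finset.sum_sub_distrib, hw1, hfx, sub_self]
  rw [← hw1]
  refine Finset.sum_congr rfl fun i hi => ?_
  rcases mul_eq_zero.1 (hz i hi) with h | h
  · simp [h]
  · rw [hfg i hi (by linarith), mul_one]

theorem apply_le_norm {f : StrongDual ℝ E} (hf : ‖f‖ ≤ 1) (y : E) : f y ≤ ‖y‖ :=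
  (le_abs_self _).trans (by simpa using f.le_of_opNorm_le hf y)

/-- The section of the ball by the span of `x` and `v` has a finite generating set, so there are
finitely many types of norming functionals. One functional therefore norms infinitely many of the
points `x + v/(n+1)`, hence also their limit `x`, hence an initial segment. -/
theorem IsPolyhedral.radiallyAffine (hE : IsPolyhedral E) : RadiallyAffine E := by
  intro x v
  obtain ⟨-, -, -, hsec⟩ := hE
  let L : Submodule ℝ E := Submodule.span ℝ {x, v}
  have hL : FiniteDimensional ℝ L := FiniteDimensional.span_of_finite ℝ (by simp)
  obtain ⟨P, hP, hBP⟩ := hsec L.toAffineSubspace (by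
    rw [Submodule.toAffineSubspace_direction]; exact hL)
  have hxL : ∀ t : ℝ, x + t • v ∈ L := fun t =>
    L.add_mem (Submodule.subset_span (by simp)) (L.smul_mem _ (Submodule.subset_span (by simp)))
  choose f hf1 hfx using fun n : ℕ => exists_dual_vector'' ℝ (x + ((n : ℝ) + 1)⁻¹ • v)
  have hP1 : ∀ n, ∀ i ∈ P, f n i ≤ 1 := fun n i hi => by
    have : i ∈ Metric.closedBall (0 : E) 1 ∩ (L.toAffineSubspace : Set E) :=
      hBP ▸ subset_convexHull ℝ P hi
    exact (apply_le_norm (hf1 n) i).trans (by simpa using this.1)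
  have key : ∀ m n, (∀ i ∈ P, f n i = 1 → f m i = 1) →
      f m (x + ((n : ℝ) + 1)⁻¹ • v) = ‖x + ((n : ℝ) + 1)⁻¹ • v‖ := by
    intro m n hmn
    set y := x + ((n : ℝ) + 1)⁻¹ • v with hy
    rcases eq_or_ne y 0 with h0 | h0
    · simp [h0]
    have hn : ‖y‖ ≠ 0 := norm_ne_zero_iff.2 h0
    have hmem : ‖y‖⁻¹ • y ∈ convexHull ℝ P := by
      rw [← hBP]
      refine ⟨?_, L.smul_mem _ (hxL _)⟩
      simp [norm_smul, hn]
    have := mem_convexHull_apply_eq_one hP (hP1 n) hmn hmem (by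
      rw [map_smul, smul_eq_mul, show f n y = ‖y‖ from hfx n]
      exact inv_mul_cancel₀ hn)
    simp only [map_smul, smul_eq_mul] at this
    field_simp at this
    exact this
  -- Pigeonhole on the subset of `P` on which `f n` equals `1`.
  obtain ⟨A, hA⟩ : ∃ A : 𝒫 P, Infinite ((fun n => (⟨{i ∈ P | f n i = 1}, sep_subset _ _⟩ : 𝒫 P))
      ⁻¹' {A}) := by
    have : Finite (𝒫 P) := hP.powerset.to_subtype
    exact Finite.exists_infinite_fiber _
  rw [Set.infinite_coe_iff] at hA
  obtain ⟨m, hm⟩ := hA.nonempty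
  have hA' : ∃ᶠ n : ℕ in atTop, f m (x + ((n : ℝ) + 1)⁻¹ • v) = ‖x + ((n : ℝ) + 1)⁻¹ • v‖ := by
    refine (Nat.frequently_atTop_iff_infinite.2 hA).mono fun n hn => key m n fun i hi h1 => ?_
    have e : {i ∈ P | f n i = 1} = {i ∈ P | f m i = 1} :=
      congrArg Subtype.val ((show _ = A from hn).trans (show _ = A from hm).symm)
    exact (e ▸ (⟨hi, h1⟩ : i ∈ {i ∈ P | f n i = 1}) : i ∈ {i ∈ P | f m i = 1}).2
  have hlim : Tendsto (fun n : ℕ => x + ((n : ℝ) + 1)⁻¹ • v) atTop (𝓝 x) := by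
    have := (tendsto_inv_atTop_zero.comp
      (tendsto_atTop_add_const_right _ (1 : ℝ) tendsto_natCast_atTop_atTop)).smul_const v
    simpa using this.const_add x
  have h0 : ‖x‖ = f m x := by
    have hcl : IsClosed {y : E | ‖y‖ = f m y} := isClosed_eq continuous_norm (f m).continuous
    exact hcl.mem_of_frequently_of_tendsto (hA'.mono fun n hn => hn.symm) hlim
  refine ⟨f m v, ((m : ℝ) + 1)⁻¹, by positivity, fun t ht0 ht1 => ?_⟩
  rw [norm_eq_apply_of_between (apply_le_norm (hf1 m)) (by positivity) ht0 ht1 h0 (hfx m).symm, h0]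
  simp

/-- The norm coincides with the functional `f` near `x`. -/
def IsLinearPoint (f : StrongDual ℝ E) (x : E) : Prop := ∀ᶠ y in 𝓝 x, ‖y‖ = f y

theorem IsLinearPoint.norm_eq {f : StrongDual ℝ E} {x : E} (h : IsLinearPoint f x) : ‖x‖ = f x :=
  h.self_of_nhds

theorem IsLinearPoint.eventually {f : StrongDual ℝ E} {x : E} (h : IsLinearPoint f x) :
    ∀ᶠ y in 𝓝 x, IsLinearPoint f y := eventually_eventually_nhds.2 h

theorem tendsto_add_smul_zero (x v : E) : Tendsto (fun t : ℝ => x + t • v) (𝓝[>] 0) (𝓝 x) := by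
  have : Continuous fun t : ℝ => x + t • v := by fun_prop
  simpa using (this.tendsto 0).mono_left nhdsWithin_le_nhds

/-- Here `g - f` is nonpositive near `x` and zero at `x`; a linear functional with a local maximum
vanishes. -/
theorem IsLinearPoint.eq_of_norming {f g : StrongDual ℝ E} {x : E} (h : IsLinearPoint f x)
    (hg : ∀ y, g y ≤ ‖y‖) (hx : g x = ‖x‖) : g = f := by
  have hle : ∀ v, g v ≤ f v := fun v => by
    obtain ⟨t, ht, ht0⟩ := (((tendsto_add_smul_zero x v).eventually h).and
      self_mem_nhdsWithin).exists
    have h1 := hg (x + t • v)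
    rw [ht, map_add, map_add, hx, h.norm_eq, map_smul, map_smul, smul_eq_mul, smul_eq_mul] at h1
    exact le_of_mul_le_mul_left (by linarith) (show (0 : ℝ) < t from ht0)
  ext v
  refine le_antisymm (hle v) ?_
  have := hle (-v)
  simp only [map_neg] at this
  linarith

/-- On a segment from a point normed by `f` to a linear point, all points but the first one are
linear. -/
theorem IsLinearPoint.combo {f : StrongDual ℝ E} (hf : ∀ y, f y ≤ ‖y‖) {x u : E} (hx : f x = ‖x‖)
    (hu : IsLinearPoint f u) {τ : ℝ} (h0 : 0 < τ) (h1 : τ ≤ 1) :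
    IsLinearPoint f ((1 - τ) • x + τ • u) := by
  have hc : Tendsto (fun y => u + τ⁻¹ • (y - ((1 - τ) • x + τ • u)))
      (𝓝 ((1 - τ) • x + τ • u)) (𝓝 u) := by
    have : Continuous fun y => u + τ⁻¹ • (y - ((1 - τ) • x + τ • u)) := by fun_prop
    simpa using this.tendsto ((1 - τ) • x + τ • u)
  filter_upwards [hc.eventually hu] with y hy
  refine le_antisymm ?_ (hf y)
  set z := u + τ⁻¹ • (y - ((1 - τ) • x + τ • u)) with hz
  have e : y = (1 - τ) • x + τ • z := by
    rw [hz, smul_add, smul_smul, mul_inv_cancel₀ h0.ne', one_smul]; abel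
  calc ‖y‖ ≤ ‖(1 - τ) • x‖ + ‖τ • z‖ := by rw [e]; exact norm_add_le _ _
    _ = (1 - τ) * f x + τ * f z := by
      rw [norm_smul, norm_smul, Real.norm_of_nonneg h0.le, Real.norm_of_nonneg (by linarith), hx,
        hy]
    _ = f y := by rw [e]; simp

end Basic

/-! ### Separable reduction -/

section Closing
variable {E : Type u} [NormedAddCommGroup E] [NormedSpace ℝ E]

/-- Closing off a countable set under an operation that preserves countability, inside a separable
closed subspace in which the resulting set is dense. -/
theorem exists_countable_closing (σ : Set E → Set E) (hσ : ∀ S, S.Countable → (σ S).Countable)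
    {S₀ : Set E} (hS₀ : S₀.Countable) :
    ∃ (T : ℕ → Set E) (X : Submodule ℝ E), Monotone T ∧ (∀ n, (T n).Countable) ∧ S₀ ⊆ T 0 ∧
      (∀ n, σ (T n) ⊆ T (n + 1)) ∧ IsClosed (X : Set E) ∧ (∀ n, T n ⊆ X) ∧
      (X : Set E) ⊆ closure (⋃ n, T n) := by
  have hD : ∀ S : Set E, ∃ D : Set E, S.Countable →
      D.Countable ∧ (Submodule.span ℝ S : Set E) ⊆ closure D := fun S => by
    by_cases hS : S.Countable
    · obtain ⟨D, h1, h2⟩ := (hS.isSeparable.span (R := ℝ))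
      exact ⟨D, fun _ => ⟨h1, h2⟩⟩
    · exact ⟨∅, fun h => absurd h hS⟩
  choose D hD using hD
  let T : ℕ → Set E := fun n => Nat.rec S₀ (fun _ S => S ∪ (σ S ∪ D S)) n
  have hT : ∀ n, T (n + 1) = T n ∪ (σ (T n) ∪ D (T n)) := fun n => rfl
  have hmono : Monotone T := monotone_nat_of_le_succ fun n => by
    rw [hT]; exact subset_union_left
  have hc : ∀ n, (T n).Countable := fun n => by
    induction n with
    | zero => exact hS₀
    | succ n ih => rw [hT]; exact ih.union ((hσ _ ih).union (hD _ ih).1)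
  have hsub : (Submodule.span ℝ (⋃ n, T n) : Set E) ⊆ closure (⋃ n, T n) := fun x hx => by
    rw [Submodule.span_iUnion, SetLike.mem_coe, Submodule.mem_iSup_of_directed _
      (Monotone.directed_le fun m n h => Submodule.span_mono (hmono h))] at hx
    obtain ⟨n, hn⟩ := hx
    refine closure_mono ?_ ((hD _ (hc n)).2 hn)
    refine subset_iUnion_of_subset (n + 1) ?_
    rw [hT]
    exact subset_union_right.trans subset_union_right
  refine ⟨T, (Submodule.span ℝ (⋃ n, T n)).topologicalClosure, hmono, hc, Subset.rfl, fun n => ?_,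
    Submodule.isClosed_topologicalClosure _, fun n => ?_, ?_⟩
  · rw [hT]
    exact subset_union_left.trans subset_union_right
  · exact (subset_iUnion T n).trans (Submodule.subset_span.trans
      (Submodule.le_topologicalClosure _))
  · rw [Submodule.topologicalClosure_coe]
    exact closure_minimal hsub isClosed_closure

theorem separableSpace_of_subset_closure {X : Submodule ℝ E} {T : ℕ → Set E}
    (hT : ∀ n, (T n).Countable) (hX : (X : Set E) ⊆ closure (⋃ n, T n)) :
    TopologicalSpace.SeparableSpace X :=
  TopologicalSpace.IsSeparable.separableSpace ⟨_, countable_iUnion hT, hX⟩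

theorem exists_mem_of_isOpen_submodule {X : Submodule ℝ E} {S : Set E} (hS : S ⊆ X)
    (hX : (X : Set E) ⊆ closure S) {U : Set X} (hU : IsOpen U) (hne : U.Nonempty) :
    ∃ x : X, (x : E) ∈ S ∧ x ∈ U := by
  obtain ⟨V, hV, rfl⟩ := isOpen_induced_iff.1 hU
  obtain ⟨y, hy⟩ := hne
  obtain ⟨t, htV, htS⟩ := mem_closure_iff.1 (hX y.2) V hV hy
  exact ⟨⟨t, hS htS⟩, htS, htV⟩

end Closing

/-! ### Existence of linear points by Baire category -/

section LinearPoints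
variable {E : Type u} [NormedAddCommGroup E] [NormedSpace ℝ E]

/-- Two-sided directional linearity of the norm at `y`. -/
def IsSmoothPoint (y : E) : Prop := ∀ v : E, ∃ t : ℝ, 0 < t ∧ ‖y + t • v‖ + ‖y - t • v‖ ≤ 2 * ‖y‖

/-- A functional `f` norming `y` agrees with the norm on a short segment in every direction. Baire's
theorem in the space of directions makes the length uniform on an open set of them, and the points
reached along these directions form an open set. -/
theorem IsSmoothPoint.exists_linearPoint [CompleteSpace E] {y : E} (hy : IsSmoothPoint y)
    {r : ℝ} (hr : 0 < r) :
    ∃ z f, dist z y < r ∧ (∀ w, f w ≤ ‖w‖) ∧ IsLinearPoint (E := E) f z := by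
  obtain ⟨f, hf1, hfy⟩ := exists_dual_vector'' ℝ y
  have hf := apply_le_norm hf1
  let A : ℕ → Set E := fun n =>
    {v | ‖y + ((n : ℝ) + 1)⁻¹ • v‖ = f (y + ((n : ℝ) + 1)⁻¹ • v)}
  have hmono : Monotone A := fun m n hmn v hv => by
    refine norm_eq_apply_of_between hf (s := ((m : ℝ) + 1)⁻¹) (by positivity) (by positivity) ?_
      hfy.symm hv
    gcongr
  have hcl : ∀ n, IsClosed (A n) := fun n =>
    isClosed_eq (by fun_prop) (by fun_prop)
  have hU : ⋃ n, A n = univ := by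
    refine eq_univ_of_forall fun v => mem_iUnion.2 ?_
    obtain ⟨t, ht, h⟩ := hy v
    have h1 : ‖y + t • v‖ = f (y + t • v) := by
      have e1 := hf (y + t • v)
      have e2 := hf (y - t • v)
      have e3 : f (y + t • v) + f (y - t • v) = 2 * f y := by
        rw [map_add, map_sub]; ring
      have e4 : f y = ‖y‖ := hfy
      linarith
    obtain ⟨n, hn⟩ := exists_nat_one_div_lt ht
    rw [one_div] at hn
    exact ⟨n, norm_eq_apply_of_between hf ht (by positivity) hn.le hfy.symm h1⟩
  obtain ⟨n, v, hv⟩ := nonempty_interior_of_iUnion_of_closed hcl hU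
  have hlim : Tendsto (fun m : ℕ => y + ((m : ℝ) + 1)⁻¹ • v) atTop (𝓝 y) := by
    have := (tendsto_inv_atTop_zero.comp
      (tendsto_atTop_add_const_right _ (1 : ℝ) tendsto_natCast_atTop_atTop)).smul_const v
    simpa using this.const_add y
  obtain ⟨m, hm, hnm⟩ := ((hlim.eventually (Metric.ball_mem_nhds y hr)).and
    (eventually_ge_atTop n)).exists
  refine ⟨y + ((m : ℝ) + 1)⁻¹ • v, f, hm, hf, ?_⟩
  have hc : Tendsto (fun w => ((m : ℝ) + 1) • (w - y)) (𝓝 (y + ((m : ℝ) + 1)⁻¹ • v)) (𝓝 v) := by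
    have : Continuous fun w => ((m : ℝ) + 1) • (w - y) := by fun_prop
    have h2 := this.tendsto (y + ((m : ℝ) + 1)⁻¹ • v)
    rwa [add_sub_cancel_left, smul_smul, mul_inv_cancel₀ (by positivity), one_smul] at h2
  filter_upwards [hc.eventually (isOpen_interior.mem_nhds hv)] with w hw
  have hw' : _ = _ := hmono hnm (interior_subset hw)
  rwa [smul_smul, inv_mul_cancel₀ (by positivity), one_smul, add_sub_cancel] at hw'

/-- Smallness of second difference quotients in the directions of a dense sequence holds on a dense
`G_δ`. At such a point the slopes along `v` and `-v` have sum at most `0`, and radial affinity turns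
this into an exact statement at a positive `t`. -/
theorem exists_smoothPoint [CompleteSpace E] [TopologicalSpace.SeparableSpace E]
    (hE : RadiallyAffine E) (x : E) {r : ℝ} (hr : 0 < r) : ∃ y, dist y x < r ∧ IsSmoothPoint y := by
  let q := TopologicalSpace.denseSeq E
  let G : ℕ × ℕ → Set E := fun p => {y | ∃ t : ℝ, 0 < t ∧
    ‖y + t • q p.1‖ + ‖y - t • q p.1‖ - 2 * ‖y‖ < t * ((p.2 : ℝ) + 1)⁻¹}
  have hGo : ∀ p, IsOpen (G p) := fun p => by
    have : G p = ⋃ t ∈ Ioi (0 : ℝ), {y | ‖y + t • q p.1‖ + ‖y - t • q p.1‖ - 2 * ‖y‖ <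
        t * ((p.2 : ℝ) + 1)⁻¹} := by ext; simp [G]
    rw [this]
    exact isOpen_biUnion fun t _ => isOpen_lt (by fun_prop) continuous_const
  have hGd : ∀ p, Dense (G p) := fun p => by
    refine Metric.dense_iff.2 fun z ε hε => ?_
    obtain ⟨s, δ, hδ, H⟩ := hE z (q p.1)
    obtain ⟨t, ⟨htδ, htz⟩, ht⟩ := (((((eventually_le_nhds hδ).filter_mono
      (nhdsWithin_le_nhds (s := Ioi 0))).and ((tendsto_add_smul_zero z (q p.1)).eventually
      (Metric.ball_mem_nhds z hε)))).and self_mem_nhdsWithin).exists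
    have ht : 0 < t := ht
    -- At the midpoint of a segment on which the norm is affine, the second difference is zero.
    refine ⟨z + (t / 2) • q p.1, ?_, t / 2, by positivity, ?_⟩
    · rw [Metric.mem_ball]
      rw [dist_eq_norm, add_sub_cancel_left] at htz ⊢
      refine lt_of_le_of_lt ?_ htz
      rw [norm_smul, norm_smul, Real.norm_of_nonneg ht.le, Real.norm_of_nonneg (by positivity)]
      exact mul_le_mul_of_nonneg_right (by linarith) (norm_nonneg _)
    · rw [add_assoc, ← add_smul, add_halves, add_sub_cancel_right, H t ht.le htδ,
        H (t / 2) (by positivity) (by linarith)]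
      have : 0 < t / 2 * ((p.2 : ℝ) + 1)⁻¹ := by positivity
      linarith
  obtain ⟨y, hyx, hy⟩ := (dense_iInter_of_isOpen hGo hGd).inter_open_nonempty _ Metric.isOpen_ball
    ⟨x, Metric.mem_ball_self hr⟩
  refine ⟨y, hyx, fun v => ?_⟩
  obtain ⟨s, δ, hδ, H, H'⟩ := hE.exists_slope y v
  obtain ⟨s', δ', hδ', K, K'⟩ := hE.exists_slope y (-v)
  have hss : s + s' ≤ 0 := by
    refine le_of_forall_pos_lt_add fun ε hε => ?_
    obtain ⟨n, hn⟩ := exists_nat_one_div_lt (half_pos hε)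
    obtain ⟨k, hk⟩ := (TopologicalSpace.denseRange_denseSeq E).exists_dist_lt v
      (show 0 < ε / 4 by positivity)
    obtain ⟨t, ht, htn⟩ := mem_iInter.1 hy (k, n)
    rw [dist_eq_norm] at hk
    have a1 : ‖y + t • v‖ ≤ ‖y + t • q k‖ + t * ‖v - q k‖ := by
      have := norm_add_le (y + t • q k) (t • (v - q k))
      rwa [norm_smul, Real.norm_of_nonneg ht.le, show y + t • q k + t • (v - q k) = y + t • v by
        module] at this
    have a2 : ‖y + t • (-v)‖ ≤ ‖y - t • q k‖ + t * ‖v - q k‖ := by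
      have := norm_sub_le (y - t • q k) (t • (v - q k))
      rwa [norm_smul, Real.norm_of_nonneg ht.le, show y - t • q k - t • (v - q k) = y + t • (-v) by
        module] at this
    have a3 := H' t ht.le
    have a4 := K' t ht.le
    rw [one_div] at hn
    have a5 : t * ((n : ℝ) + 1)⁻¹ < t * (ε / 2) := mul_lt_mul_of_pos_left hn ht
    have a6 : t * ‖v - q k‖ < t * (ε / 4) := mul_lt_mul_of_pos_left hk ht
    refine lt_of_mul_lt_mul_left (a := t) ?_ ht.le
    have a7 : ‖y + t • q k‖ + ‖y - t • q k‖ - 2 * ‖y‖ < t * ((n : ℝ) + 1)⁻¹ := htn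
    nlinarith
  refine ⟨min δ δ', lt_min hδ hδ', ?_⟩
  have hm : 0 < min δ δ' := lt_min hδ hδ'
  have b1 := H _ hm.le (min_le_left _ _)
  have b2 := K _ hm.le (min_le_right _ _)
  rw [smul_neg, ← sub_eq_add_neg] at b2
  rw [b1, b2]
  nlinarith

/-- Otherwise every point near `x` has a direction `w y` of genuine kink. In a separable subspace
`X` closed off under `w` there are linear points; one of them lies in the closed-off set, and its
own kink direction belongs to `X`, a contradiction. -/
theorem exists_linearPoint_near [CompleteSpace E] (hE : RadiallyAffine E) (x : E) {r : ℝ}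
    (hr : 0 < r) : ∃ z f, dist z x < r ∧ (∀ w, f w ≤ ‖w‖) ∧ IsLinearPoint (E := E) f z := by
  by_contra hcon
  have hns : ∀ y, dist y x < r → ∃ v : E, ∀ t : ℝ, 0 < t →
      2 * ‖y‖ < ‖y + t • v‖ + ‖y - t • v‖ := fun y hy => by
    by_contra h
    have hs : IsSmoothPoint y := by
      simpa only [IsSmoothPoint, not_exists, not_forall, not_lt, exists_prop] using h
    obtain ⟨z, f, hz, hf, hl⟩ := hs.exists_linearPoint (sub_pos.2 hy)
    exact hcon ⟨z, f, by linarith [dist_triangle z y x], hf, hl⟩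
  choose! w hw using hns
  obtain ⟨T, X, -, hc, hx, hσ, hXc, hTX, hX⟩ := exists_countable_closing (fun S => w '' S)
    (fun S hS => hS.image w) (countable_singleton x)
  have := separableSpace_of_subset_closure hc hX
  have : CompleteSpace X := hXc.completeSpace_coe
  have hxX : x ∈ X := hTX 0 (hx rfl)
  obtain ⟨y, hyx, hy⟩ := exists_smoothPoint (hE.submodule X) ⟨x, hxX⟩ (half_pos hr)
  obtain ⟨z, f, hz, hf, hl⟩ := hy.exists_linearPoint (half_pos hr)
  have hzx : dist z ⟨x, hxX⟩ < r := by linarith [dist_triangle z y ⟨x, hxX⟩]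
  obtain ⟨U, hUsub, hU, hzU⟩ := eventually_nhds_iff.1
    (hl.eventually.and (Metric.isOpen_ball.mem_nhds hzx : ∀ᶠ y in 𝓝 z, dist y ⟨x, hxX⟩ < r))
  obtain ⟨p, hpT, hpU⟩ := exists_mem_of_isOpen_submodule (iUnion_subset hTX) hX hU ⟨z, hzU⟩
  obtain ⟨hpl, hpx⟩ := hUsub p hpU
  obtain ⟨n, hn⟩ := mem_iUnion.1 hpT
  have hwX : w p ∈ X := hTX (n + 1) (hσ n (mem_image_of_mem w hn))
  let v : X := ⟨w p, hwX⟩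
  have h1 := tendsto_add_smul_zero p v
  have h2 := tendsto_add_smul_zero p (-v)
  obtain ⟨t, ⟨e1, e2⟩, ht⟩ := (((h1.eventually hpl).and (h2.eventually hpl)).and
    self_mem_nhdsWithin).exists
  have h3 := hw p hpx t ht
  have e1' : ‖(p : E) + t • w p‖ = f (p + t • v) := e1
  have e2' : ‖(p : E) - t • w p‖ = f (p + t • (-v)) := by
    rw [← e2, smul_neg, ← sub_eq_add_neg]; rfl
  have e3 : ‖(p : E)‖ = f p := hpl.norm_eq
  rw [e1', e2', e3, map_add, map_add, smul_neg, map_neg] at h3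
  linarith

/-- The functionals given by linear points form a boundary; the linear point may be chosen near
the given point. -/
theorem exists_linearPoint_norming [CompleteSpace E] (hE : RadiallyAffine E) (x : E) {r : ℝ}
    (hr : 0 < r) :
    ∃ z f, dist z x < r ∧ (∀ w, f w ≤ ‖w‖) ∧ IsLinearPoint (E := E) f z ∧ f x = ‖x‖ := by
  -- Directions whose difference quotients at `x` are constant from scale `1/(n+1)` on; by radial
  -- affinity these closed sets cover the space.
  let A : ℕ → Set E := fun n => {v | ∀ m ≥ n, ((m : ℝ) + 1) * (‖x + ((m : ℝ) + 1)⁻¹ • v‖ - ‖x‖) =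
    ((n : ℝ) + 1) * (‖x + ((n : ℝ) + 1)⁻¹ • v‖ - ‖x‖)}
  have hcl : ∀ n, IsClosed (A n) := fun n => by
    simp only [A, ofPred_forall]
    exact isClosed_iInter fun m => isClosed_iInter fun _ => isClosed_eq (by fun_prop) (by fun_prop)
  have hU : ⋃ n, A n = univ := by
    refine eq_univ_of_forall fun v => mem_iUnion.2 ?_
    obtain ⟨s, δ, hδ, H⟩ := hE x v
    obtain ⟨n, hn⟩ := exists_nat_one_div_lt hδ
    rw [one_div] at hn
    refine ⟨n, fun m hm => ?_⟩
    have hm' : ((m : ℝ) + 1)⁻¹ ≤ ((n : ℝ) + 1)⁻¹ := by gcongr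
    rw [H _ (by positivity) (hm'.trans hn.le), H _ (by positivity) hn.le]
    field_simp
    ring
  obtain ⟨n, v, hv⟩ := nonempty_interior_of_iUnion_of_closed hcl hU
  have hlim : Tendsto (fun m : ℕ => x + ((m : ℝ) + 1)⁻¹ • v) atTop (𝓝 x) := by
    have := (tendsto_inv_atTop_zero.comp
      (tendsto_atTop_add_const_right _ (1 : ℝ) tendsto_natCast_atTop_atTop)).smul_const v
    simpa using this.const_add x
  obtain ⟨m, hm, hnm⟩ := ((hlim.eventually (Metric.ball_mem_nhds x hr)).and
    (eventually_gt_atTop n)).exists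
  have hc : Tendsto (fun w => ((m : ℝ) + 1) • (w - x)) (𝓝 (x + ((m : ℝ) + 1)⁻¹ • v)) (𝓝 v) := by
    have : Continuous fun w => ((m : ℝ) + 1) • (w - x) := by fun_prop
    have h2 := this.tendsto (x + ((m : ℝ) + 1)⁻¹ • v)
    rwa [add_sub_cancel_left, smul_smul, mul_inv_cancel₀ (by positivity), one_smul] at h2
  obtain ⟨ε, hε, hball⟩ := Metric.eventually_nhds_iff.1
    ((hc.eventually (isOpen_interior.mem_nhds hv)).and
      (Metric.isOpen_ball.eventually_mem (x := x + ((m : ℝ) + 1)⁻¹ • v) hm))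
  obtain ⟨z, f, hz, hf, hl⟩ := exists_linearPoint_near hE (x + ((m : ℝ) + 1)⁻¹ • v) hε
  obtain ⟨hzA, hzx⟩ := hball hz
  refine ⟨z, f, hzx, hf, hl, le_antisymm (hf x) ?_⟩
  set u := ((m : ℝ) + 1) • (z - x) with hu
  have hzu : z = x + ((m : ℝ) + 1)⁻¹ • u := by
    rw [hu, smul_smul, inv_mul_cancel₀ (by positivity), one_smul, add_sub_cancel]
  -- The quotients of the norm at scales `m` and `n` agree. At scale `m` the norm is `f`, at scale
  -- `n` it dominates `f`, and the comparison leaves `(m - n) * ‖x‖ ≤ (m - n) * f x`; this is why `n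
  -- < m` is required strictly.
  have h1 := interior_subset hzA m hnm.le
  rw [← hzu, hl.norm_eq] at h1
  have h2 := hf (x + ((n : ℝ) + 1)⁻¹ • u)
  have h3 : ((n : ℝ) + 1) * f (x + ((n : ℝ) + 1)⁻¹ • u) = (n + 1) * f x + f u := by
    rw [map_add, map_smul, smul_eq_mul]; field_simp
  have h4 : ((m : ℝ) + 1) * f z = (m + 1) * f x + f u := by
    rw [hzu, map_add, map_smul, smul_eq_mul]; field_simp
  have h5 := mul_le_mul_of_nonneg_left h2 (show (0 : ℝ) ≤ n + 1 by positivity)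
  have h6 : (n : ℝ) < m := by exact_mod_cast hnm
  have h7 : ((m : ℝ) - n) * ‖x‖ ≤ (m - n) * f x := by nlinarith
  exact le_of_mul_le_mul_left h7 (by linarith)

end LinearPoints

/-- A weak form of Ekeland's variational principle. -/
theorem exists_ekeland {X : Type u} [MetricSpace X] [CompleteSpace X] {K : Set X}
    (hK : IsClosed K) {x₀ : X} (hx₀ : x₀ ∈ K) {g : X → ℝ} (hg : Continuous g)
    (hbdd : BddAbove (g '' K)) {δ : ℝ} (hδ : 0 < δ) :
    ∃ x ∈ K, ∀ y ∈ K, g y ≤ g x + δ * dist y x := by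
  -- The points above `x` in the Ekeland order; the sequence below climbs almost to the supremum
  -- over each such set.
  let S : X → Set X := fun x => {y | y ∈ K ∧ g x + δ * dist y x ≤ g y}
  have hstep : ∀ n : ℕ, ∀ x : X, ∃ z, x ∈ K → z ∈ S x ∧ ∀ y ∈ S x, g y ≤ g z + (1 / 2) ^ n :=
    fun n x => by
    by_cases hx : x ∈ K
    · have hb : BddAbove (g '' S x) := hbdd.mono (image_mono fun y hy => hy.1)
      have hne : (g '' S x).Nonempty := ⟨_, x, ⟨hx, by simp⟩, rfl⟩
      obtain ⟨_, ⟨z, hz, rfl⟩, hlt⟩ := exists_lt_of_lt_csSup hne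
        (show sSup (g '' S x) - (1 / 2) ^ n < sSup (g '' S x) by
          have : (0 : ℝ) < (1 / 2) ^ n := by positivity
          linarith)
      refine ⟨z, fun _ => ⟨hz, fun y hy => ?_⟩⟩
      have := le_csSup hb (mem_image_of_mem g hy)
      linarith
    · exact ⟨x, fun h => absurd h hx⟩
  choose z hz using hstep
  let a : ℕ → X := fun n => Nat.rec x₀ (fun n x => z n x) n
  have haK : ∀ n, a n ∈ K := fun n => by
    induction n with
    | zero => exact hx₀
    | succ n ih => exact (hz n _ ih).1.1
  have ha1 : ∀ n, g (a n) + δ * dist (a (n + 1)) (a n) ≤ g (a (n + 1)) :=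
    fun n => (hz n _ (haK n)).1.2
  have ha2 : ∀ n, ∀ y ∈ S (a n), g y ≤ g (a (n + 1)) + (1 / 2) ^ n := fun n => (hz n _ (haK n)).2
  have hadd : ∀ n k, g (a n) + δ * dist (a (n + k)) (a n) ≤ g (a (n + k)) := fun n k => by
    induction k with
    | zero => simp
    | succ k ih =>
      have h1 := ha1 (n + k)
      have h2 := mul_le_mul_of_nonneg_left (dist_triangle (a (n + k + 1)) (a (n + k)) (a n)) hδ.le
      rw [← add_assoc]
      linarith
  have hmono : Monotone fun n => g (a n) := monotone_nat_of_le_succ fun n => by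
    have := ha1 n
    have h2 : 0 ≤ δ * dist (a (n + 1)) (a n) := by positivity
    linarith
  have hgb : BddAbove (range fun n => g (a n)) := hbdd.mono (by
    rintro _ ⟨n, rfl⟩; exact mem_image_of_mem g (haK n))
  have hglim := tendsto_atTop_ciSup hmono hgb
  have hcau : CauchySeq a := by
    have hgc := hglim.cauchySeq
    refine Metric.cauchySeq_iff'.2 fun ε hε => ?_
    obtain ⟨N, hN⟩ := Metric.cauchySeq_iff'.1 hgc (δ * ε) (by positivity)
    refine ⟨N, fun n hn => ?_⟩
    obtain ⟨k, rfl⟩ := Nat.exists_eq_add_of_le hn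
    have h1 := hN (N + k) hn
    rw [Real.dist_eq] at h1
    have h2 := hadd N k
    exact lt_of_mul_lt_mul_left (by linarith [le_abs_self (g (a (N + k)) - g (a N))]) hδ.le
  obtain ⟨x, hx⟩ := cauchySeq_tendsto_of_complete hcau
  have hxK : x ∈ K := hK.mem_of_tendsto hx (Eventually.of_forall haK)
  have hgx : Tendsto (fun n => g (a n)) atTop (𝓝 (g x)) := (hg.tendsto x).comp hx
  have hxS : ∀ n, g (a n) + δ * dist x (a n) ≤ g x := fun n => by
    refine le_of_tendsto_of_tendsto ?_ hgx (eventually_ge_atTop n |>.mono fun m hm => ?_)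
      (f := fun m => g (a n) + δ * dist (a m) (a n))
    · exact ((hx.dist tendsto_const_nhds).const_mul δ).const_add _
    · obtain ⟨k, rfl⟩ := Nat.exists_eq_add_of_le hm
      exact hadd n k
  refine ⟨x, hxK, fun y hy => ?_⟩
  by_contra! hlt
  have hyS : ∀ n, y ∈ S (a n) := fun n => by
    refine ⟨hy, ?_⟩
    have := mul_le_mul_of_nonneg_left (dist_triangle y x (a n)) hδ.le
    linarith [hxS n]
  have hpow : Tendsto (fun n : ℕ => ((1 : ℝ) / 2) ^ n) atTop (𝓝 0) :=
    tendsto_pow_atTop_nhds_zero_of_lt_one (by norm_num) (by norm_num)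
  have hle : g y ≤ g x + 0 := le_of_tendsto_of_tendsto tendsto_const_nhds
    ((hgx.comp (tendsto_add_atTop_nat 1)).add hpow) (Eventually.of_forall fun n => ha2 n y (hyS n))
  have : 0 ≤ δ * dist y x := by positivity
  linarith

/-! ### Norming a slice forces dense span in the dual -/

section Dual
variable {E : Type u} [NormedAddCommGroup E] [NormedSpace ℝ E]

/-- A functional that is small on a finite intersection of kernels is close to the span of the
corresponding functionals. -/
theorem exists_mem_span_norm_sub_le {ι : Type*} [Finite ι] (L : ι → StrongDual ℝ E)
    (g : StrongDual ℝ E) {δ : ℝ} (hδ : 0 ≤ δ) (h : ∀ v, (∀ i, L i v = 0) → g v ≤ δ * ‖v‖) :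
    ∃ ψ ∈ Submodule.span ℝ (range L), ‖g - ψ‖ ≤ δ := by
  let W : Submodule ℝ E := ⨅ i, LinearMap.ker (L i : E →ₗ[ℝ] ℝ)
  have hW : ∀ v, v ∈ W ↔ ∀ i, L i v = 0 := fun v => by simp [W]
  obtain ⟨g', hg', hn⟩ := exists_extension_norm_eq W (g.comp W.subtypeL)
  have hle : ‖g.comp W.subtypeL‖ ≤ δ := ContinuousLinearMap.opNorm_le_bound _ hδ fun v => by
    have h1 := h v ((hW _).1 v.2)
    have h2 := h (-v) ((hW _).1 (W.neg_mem v.2))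
    rw [map_neg, norm_neg] at h2
    exact abs_le.2 ⟨by simpa using (by linarith : -(δ * ‖(v : E)‖) ≤ g v), h1⟩
  have hker : ⨅ i, LinearMap.ker (ContinuousLinearMap.coeLM ℝ (L i)) ≤
      LinearMap.ker (ContinuousLinearMap.coeLM ℝ (g - g')) := fun v hv => by
    have := hg' ⟨v, hv⟩
    simp only [LinearMap.mem_ker]
    change g v - g' v = 0
    rw [this]
    simp
  have := mem_span_of_iInf_ker_le_ker hker
  have hr : range (fun i => ContinuousLinearMap.coeLM ℝ (L i)) =
      (ContinuousLinearMap.coeLM ℝ : (E →L[ℝ] ℝ) →ₗ[ℝ] E →ₗ[ℝ] ℝ) '' range L := by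
    rw [← range_comp]; rfl
  rw [hr, ← Submodule.map_span] at this
  obtain ⟨ψ, hψ, he⟩ := this
  have he' : ψ = g - g' := ContinuousLinearMap.coe_injective he
  exact ⟨ψ, hψ, by rw [he', sub_sub_cancel, hn]; exact hle⟩

/-- If countably many functionals norm every unit vector of an affine hyperplane `{h = h x₀}`
through an interior point `x₀` of the ball, then together with `h` they span the dual densely. -/
theorem exists_mem_span_of_countable_norming [CompleteSpace E] (h : StrongDual ℝ E) {x₀ : E}
    (hx₀ : ‖x₀‖ < 1) (φ : ℕ → StrongDual ℝ E) (hφ : ∀ n y, φ n y ≤ ‖y‖)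
    (H : ∀ y, ‖y‖ = 1 → h y = h x₀ → ∃ n, φ n y = 1) (g : StrongDual ℝ E) {δ : ℝ} (hδ : 0 < δ) :
    ∃ ψ ∈ Submodule.span ℝ (insert h (range φ)), ‖g - ψ‖ ≤ δ := by
  set ε : ℝ := 1 - ‖x₀‖ with hε
  have hε0 : 0 < ε := by linarith
  -- Strictly above `1`, decreasing to `1`, and at most `2 - ‖x₀‖`, so that `c n * ‖x₀‖ ≤ 1` and
  -- `x₀` satisfies every constraint.
  let c : ℕ → ℝ := fun n => 1 + ε / ((n : ℝ) + 1)
  have hc1 : ∀ n, 1 < c n := fun n => by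
    have : 0 < ε / ((n : ℝ) + 1) := by positivity
    simp only [c]; linarith
  have hcanti : Antitone c := fun m n hmn => by
    simp only [c]; gcongr
  have hclim : Tendsto c atTop (𝓝 1) := by
    have : Tendsto (fun n : ℕ => ε / ((n : ℝ) + 1)) atTop (𝓝 0) :=
      tendsto_const_nhds.div_atTop
        (tendsto_atTop_add_const_right _ (1 : ℝ) tendsto_natCast_atTop_atTop)
    simpa using this.const_add 1
  let K : Set E := {y | h y = h x₀ ∧ ∀ n, c n * φ n y ≤ 1}
  have hKcl : IsClosed K := by
    have hK : K = {y | h y = h x₀} ∩ ⋂ n, {y | c n * φ n y ≤ 1} := by ext; simp [K]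
    rw [hK]
    exact (isClosed_eq (by fun_prop) (by fun_prop)).inter
      (isClosed_iInter fun n => isClosed_le (by fun_prop) (by fun_prop))
  have hx₀K : x₀ ∈ K := by
    refine ⟨rfl, fun n => ?_⟩
    have h1 : c n ≤ 1 + ε := by
      have : ε / ((n : ℝ) + 1) ≤ ε := div_le_self hε0.le (by simp)
      simp only [c]; linarith
    have h2 := mul_le_mul_of_nonneg_left (hφ n x₀) (zero_le_one.trans (hc1 n).le)
    have h3 := mul_le_mul_of_nonneg_right h1 (norm_nonneg x₀)
    nlinarith [sq_nonneg (1 - ‖x₀‖)]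
  -- A segment from `x₀` to a point of norm at least `1` would cross the sphere inside the
  -- hyperplane, where some `φ n` is `1` and so `c n * φ n > 1`.
  have hKn : ∀ y ∈ K, ‖y‖ < 1 := fun y hy => by
    by_contra! hlt
    have hcont : ContinuousOn (fun t : ℝ => ‖x₀ + t • (y - x₀)‖) (Icc 0 1) := by fun_prop
    obtain ⟨t, ⟨ht0, ht1⟩, ht⟩ := intermediate_value_Icc zero_le_one hcont
      (show (1 : ℝ) ∈ Icc _ _ by constructor <;> simp [hx₀.le, hlt])
    obtain ⟨n, hn⟩ := H _ ht (by simp [hy.1])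
    have h1 := hy.2 n
    have h2 := hx₀K.2 n
    have h3 := hc1 n
    have h4 : c n * φ n (x₀ + t • (y - x₀)) =
        (1 - t) * (c n * φ n x₀) + t * (c n * φ n y) := by
      simp only [map_add, map_smul, map_sub, smul_eq_mul]; ring
    rw [hn] at h4
    nlinarith
  have hbdd : BddAbove (g '' K) := by
    refine ⟨‖g‖, ?_⟩
    rintro _ ⟨y, hy, rfl⟩
    calc g y ≤ ‖g y‖ := le_abs_self _
      _ ≤ ‖g‖ * ‖y‖ := g.le_opNorm y
      _ ≤ ‖g‖ := mul_le_of_le_one_right (norm_nonneg _) (hKn y hy).le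
  obtain ⟨x, hxK, hx⟩ := exists_ekeland hKcl hx₀K g.continuous hbdd hδ
  -- Near `x` the constraints of index at least `N` hold automatically, so moving along the common
  -- kernel of `h` and the first `N` functionals stays in `K`.
  have hN : ∃ N, c N * ‖x‖ < 1 := by
    have := hclim.mul_const ‖x‖
    rw [one_mul] at this
    exact (this.eventually (gt_mem_nhds (hKn x hxK))).exists
  obtain ⟨N, hN⟩ := hN
  let L : Option (Fin N) → StrongDual ℝ E := fun o => o.elim h fun i => φ i
  obtain ⟨ψ, hψ, hle⟩ := exists_mem_span_norm_sub_le L g hδ.le fun v hv => by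
    have hnear : ∀ᶠ y in 𝓝 x, c N * ‖y‖ < 1 :=
      (continuous_const.mul continuous_norm).continuousAt.eventually (gt_mem_nhds hN)
    obtain ⟨t, ht, ht0⟩ := (((tendsto_add_smul_zero x v).eventually hnear).and
      self_mem_nhdsWithin).exists
    have ht0 : 0 < t := ht0
    have hK' : x + t • v ∈ K := by
      refine ⟨?_, fun n => ?_⟩
      · have : h v = 0 := hv none
        rw [map_add, map_smul, this, smul_zero, add_zero, hxK.1]
      · rcases lt_or_ge n N with hn | hn
        · have : φ n v = 0 := hv (some ⟨n, hn⟩)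
          rw [map_add, map_smul, this, smul_zero, add_zero]
          exact hxK.2 n
        · calc c n * φ n (x + t • v) ≤ c n * ‖x + t • v‖ :=
                mul_le_mul_of_nonneg_left (hφ _ _) (zero_le_one.trans (hc1 n).le)
            _ ≤ c N * ‖x + t • v‖ := mul_le_mul_of_nonneg_right (hcanti hn) (norm_nonneg _)
            _ ≤ 1 := ht.le
    have h1 := hx _ hK'
    rw [dist_eq_norm, add_sub_cancel_left, norm_smul, Real.norm_of_nonneg ht0.le, map_add,
      map_smul, smul_eq_mul] at h1
    exact le_of_mul_le_mul_left (by linarith) ht0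
  refine ⟨ψ, Submodule.span_mono ?_ hψ, hle⟩
  rintro _ ⟨o, rfl⟩
  cases o with
  | none => exact mem_insert _ _
  | some i => exact mem_insert_of_mem _ (mem_range_self _)

/-- A set of functionals norming every unit vector of a slice `{h > a}` through the open ball spans,
together with `h`, a norm-dense subspace of the dual. -/
theorem mem_closure_span_of_norming [CompleteSpace E] (hE : RadiallyAffine E)
    (h : StrongDual ℝ E) {a : ℝ} {x₀ : E} (hx₀ : ‖x₀‖ < 1) (ha : a < h x₀)
    (B : Set (StrongDual ℝ E)) (hB : ∀ f ∈ B, ∀ y, f y ≤ ‖y‖)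
    (H : ∀ y, ‖y‖ = 1 → a < h y → ∃ f ∈ B, f y = 1) (g : StrongDual ℝ E) :
    g ∈ closure (Submodule.span ℝ (insert h B) : Set (StrongDual ℝ E)) := by
  set M := Submodule.span ℝ (insert h B) with hM
  by_contra hg
  obtain ⟨ρ, hρ, hdist⟩ : ∃ ρ > 0, ∀ φ ∈ M, ρ ≤ ‖g - φ‖ := by
    simpa [Metric.mem_closure_iff, dist_eq_norm] using hg
  -- The hypothesis extended by homogeneity to the cone over the slice; `0` is a dummy value off
  -- this cone.
  have hb : ∀ y : E, ∃ f ∈ insert 0 B, y ≠ 0 → a * ‖y‖ < h y → f y = ‖y‖ := fun y => by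
    by_cases hy : y ≠ 0 ∧ a * ‖y‖ < h y
    · have hn : 0 < ‖y‖ := norm_pos_iff.2 hy.1
      obtain ⟨f, hf, hfy⟩ := H (‖y‖⁻¹ • y) (by simp [norm_smul, hn.ne']) (by
        rw [map_smul, smul_eq_mul, inv_mul_eq_div, lt_div_iff₀ hn]; exact hy.2)
      refine ⟨f, mem_insert_of_mem _ hf, fun _ _ => ?_⟩
      rw [map_smul, smul_eq_mul] at hfy
      field_simp at hfy
      exact hfy
    · exact ⟨0, mem_insert _ _, fun h1 h2 => absurd ⟨h1, h2⟩ hy⟩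
  choose b hbB hb using hb
  have hbM : ∀ y, b y ∈ M := fun y => by
    rcases hbB y with h0 | h0
    · rw [h0]; exact M.zero_mem
    · exact Submodule.subset_span (mem_insert_of_mem _ h0)
  have hble : ∀ y w, b y w ≤ ‖w‖ := fun y w => by
    rcases hbB y with h0 | h0
    · rw [h0]; exact norm_nonneg _
    · exact hB _ h0 w
  -- Witnesses of the distance from `g` to `M`. Closing off under them keeps `g` away from the span
  -- after restriction to `X`.
  have hw : ∀ φ : StrongDual ℝ E, ∃ w, φ ∈ M → ρ / 2 * ‖w‖ < ‖(g - φ) w‖ := fun φ => by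
    by_cases hφ : φ ∈ M
    · by_contra! hcon
      have := (g - φ).opNorm_le_bound (half_pos hρ).le fun w => (hcon w).2
      linarith [hdist φ hφ]
    · exact ⟨0, fun h => absurd h hφ⟩
  choose w hw using hw
  have hP : ∀ S : Set E, ∃ P : Set (StrongDual ℝ E), S.Countable → P.Countable ∧
      P ⊆ Submodule.span ℝ (insert h (b '' S)) ∧
      (Submodule.span ℝ (insert h (b '' S)) : Set (StrongDual ℝ E)) ⊆ closure P := fun S => by
    by_cases hS : S.Countable
    · obtain ⟨P, h1, h2, h3⟩ := (((hS.image b).insert h).isSeparable.span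
        (R := ℝ)).exists_countable_dense_subset
      exact ⟨P, fun _ => ⟨h2, h1, h3⟩⟩
    · exact ⟨∅, fun h => absurd h hS⟩
  choose P hP using hP
  have hsub : ∀ S : Set E, Submodule.span ℝ (insert h (b '' S)) ≤ M := fun S => by
    refine Submodule.span_le.2 (insert_subset (Submodule.subset_span (mem_insert _ _)) ?_)
    rintro _ ⟨y, -, rfl⟩
    exact hbM y
  obtain ⟨T, X, hmono, hc, hx, hσ, hXc, hTX, hX⟩ := exists_countable_closing
    (fun S => w '' P S) (fun S hS => (hP S hS).1.image w) (countable_singleton x₀)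
  have : CompleteSpace X := hXc.completeSpace_coe
  obtain ⟨e, he⟩ := (countable_iUnion hc).exists_eq_range ⟨x₀, mem_iUnion.2 ⟨0, hx rfl⟩⟩
  let R : StrongDual ℝ E →ₗ[ℝ] StrongDual ℝ X :=
    { toFun := fun f => f.comp X.subtypeL
      map_add' := fun _ _ => rfl
      map_smul' := fun _ _ => rfl }
  obtain ⟨ψ, hψ, hψle⟩ := exists_mem_span_of_countable_norming (R h)
    (x₀ := ⟨x₀, hTX 0 (hx rfl)⟩) hx₀ (fun n => R (b (e n))) (fun n y => hble _ _) (by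
      intro y hy1 hyh
      have hy0 : y ≠ 0 := by rintro rfl; simp at hy1
      have hopen : ∀ᶠ z : X in 𝓝 y, z ≠ 0 ∧ a * ‖z‖ < R h z := by
        refine (isOpen_ne.eventually_mem hy0).and ?_
        refine (isOpen_lt (by fun_prop) (R h).continuous).eventually_mem ?_
        change a * ‖y‖ < R h y
        rw [hy1, hyh, mul_one]
        exact ha
      obtain ⟨r, hr, hball⟩ := Metric.eventually_nhds_iff.1 hopen.eventually_nhds
      obtain ⟨z, f, hz, hf, hl, hfy⟩ := exists_linearPoint_norming (hE.submodule X) y hr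
      obtain ⟨U, hUsub, hU, hzU⟩ := eventually_nhds_iff.1 (hl.eventually.and (hball hz))
      obtain ⟨t, htT, htU⟩ := exists_mem_of_isOpen_submodule (iUnion_subset hTX) hX hU ⟨z, hzU⟩
      obtain ⟨htl, ht0, hta⟩ := hUsub t htU
      have ht0' : (t : E) ≠ 0 := fun h0 => ht0 (Subtype.ext h0)
      -- At a linear point of `X` lying in the countable set, the chosen norming functional must
      -- restrict to `f`, which also norms `y`.
      have hRf : R (b t) = f := htl.eq_of_norming (fun v => hble _ _) (hb t ht0' hta)
      rw [he] at htT
      obtain ⟨n, hn⟩ := htT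
      refine ⟨n, ?_⟩
      rw [hn, hRf, hfy, hy1]) (R g) (show 0 < ρ / 8 by positivity)
  have hins : insert (R h) (range fun n => R (b (e n))) = R '' insert h (b '' ⋃ n, T n) := by
    rw [he, image_insert_eq, ← range_comp, ← range_comp]; rfl
  rw [hins, ← Submodule.map_span] at hψ
  obtain ⟨ψ', hψ', rfl⟩ := hψ
  have hun : insert h (b '' ⋃ n, T n) = ⋃ n, insert h (b '' T n) := by
    rw [image_iUnion, insert_eq, union_iUnion]; rfl
  rw [hun, Submodule.span_iUnion, SetLike.mem_coe, Submodule.mem_iSup_of_directed _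
    (Monotone.directed_le fun m n hmn =>
      Submodule.span_mono (insert_subset_insert (image_mono (hmono hmn))))] at hψ'
  obtain ⟨n, hn⟩ := hψ'
  obtain ⟨φ, hφ, hφd⟩ := Metric.mem_closure_iff.1 ((hP _ (hc n)).2.2 hn) (ρ / 8) (by positivity)
  have hφM : φ ∈ M := hsub _ ((hP _ (hc n)).2.1 hφ)
  have hwX : w φ ∈ X := hTX (n + 1) (hσ n (mem_image_of_mem w hφ))
  have h1 := hw φ hφM
  have h2 : ‖(R g - R ψ') ⟨w φ, hwX⟩‖ ≤ ρ / 8 * ‖w φ‖ :=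
    (R g - R ψ').le_of_opNorm_le hψle ⟨w φ, hwX⟩
  have h3 : ‖(ψ' - φ) (w φ)‖ ≤ ρ / 8 * ‖w φ‖ :=
    (ψ' - φ).le_of_opNorm_le (by rw [← dist_eq_norm]; exact hφd.le) _
  have h4 : ‖(g - φ) (w φ)‖ ≤ ‖(R g - R ψ') ⟨w φ, hwX⟩‖ + ‖(ψ' - φ) (w φ)‖ := by
    refine le_trans (le_of_eq ?_) (norm_add_le _ _)
    congr 1
    change g (w φ) - φ (w φ) = (g (w φ) - ψ' (w φ)) + (ψ' (w φ) - φ (w φ))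
    ring
  have h5 : 0 ≤ ρ * ‖w φ‖ := by positivity
  linarith

end Dual

/-! ### Density character and spanning sets of the dual -/

section Density
variable {E : Type u} [NormedAddCommGroup E] [NormedSpace ℝ E]

/-- Finite rational combinations of `S` suffice. -/
theorem exists_subset_closure_span (S : Set E) :
    ∃ D : Set E, Cardinal.mk D ≤ max Cardinal.aleph0 (Cardinal.mk S) ∧
      (Submodule.span ℝ S : Set E) ⊆ closure D := by
  let F : (S →₀ ℚ) →+ E := Finsupp.liftAddHom fun s =>
    ((AddMonoidHom.flip (smulAddHom ℝ E)) (s : E)).comp (Rat.castHom ℝ : ℚ →+ ℝ)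
  have hF : ∀ (s : S) (q : ℚ), F (Finsupp.single s q) = (q : ℝ) • (s : E) := fun s q => by
    simp [F]
  refine ⟨range F, ?_, ?_⟩
  · refine Cardinal.mk_range_le.trans ?_
    rcases isEmpty_or_nonempty S with h | h
    · exact (Cardinal.le_one_iff_subsingleton.2 inferInstance).trans
        (Cardinal.one_le_aleph0.trans (le_max_left _ _))
    · rw [Cardinal.mk_finsupp_lift_of_infinite']
      simp [max_comm]
  · have hq : ∀ (q : ℚ) (x : S →₀ ℚ), (q : ℝ) • F x = F (q • x) := fun q x => by
      induction x using Finsupp.induction_linear with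
      | zero => simp
      | add x y hx hy => rw [map_add, smul_add, hx, hy, smul_add, map_add]
      | single s r => rw [hF, Finsupp.smul_single, hF, smul_smul, smul_eq_mul, Rat.cast_mul]
    let A := F.range.topologicalClosure
    have hA : (A : Set E) = closure (range F) := by
      rw [AddSubgroup.topologicalClosure_coe, AddMonoidHom.coe_range]
    have hr : ∀ (r : ℝ), ∀ x ∈ A, r • x ∈ A := fun r x hx => by
      have h1 : ∀ y ∈ range F, r • y ∈ closure (range F) := by
        rintro _ ⟨y, rfl⟩
        refine Rat.denseRange_cast.induction_on (p := fun r : ℝ => r • F y ∈ closure (range F)) r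
          (isClosed_closure.preimage (by fun_prop)) fun q => ?_
        rw [hq]
        exact subset_closure (mem_range_self _)
      rw [← SetLike.mem_coe, hA] at hx ⊢
      have := map_mem_closure (continuous_const_smul r) hx h1
      rwa [closure_closure] at this
    let A' : Submodule ℝ E := { A with smul_mem' := fun r x hx => hr r x hx }
    rw [← hA]
    refine (Submodule.span_le (p := A')).2 fun s hs => ?_
    change s ∈ (A : Set E)
    rw [hA]
    refine subset_closure ⟨Finsupp.single ⟨s, hs⟩ 1, ?_⟩
    rw [hF]; simp

theorem exists_functional_vanishing {K : Submodule ℝ E} (hK : IsClosed (K : Set E)) {y : E}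
    (hy : y ∉ K) : ∃ g : StrongDual ℝ E, g ≠ 0 ∧ ∀ k ∈ K, g k = 0 := by
  obtain ⟨g, u, hgu, huy⟩ := geometric_hahn_banach_closed_point K.convex hK hy
  have hu : 0 < u := by simpa using hgu 0 K.zero_mem
  refine ⟨g, ?_, fun k hk => ?_⟩
  · rintro rfl
    simp at huy
    linarith
  · by_contra hne
    have := hgu ((u / g k) • k) (K.smul_mem _ hk)
    rw [map_smul, smul_eq_mul, div_mul_cancel₀ _ hne] at this
    exact lt_irrefl _ this

/-- The usual proof that `E` is no denser than its dual: points almost norming a dense set of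
functionals span a dense subspace, since a nonzero `g` vanishing on them would be close to some `φ`
that is large at its own point. -/
theorem dens_le_of_closure_span_dual {S : Set (StrongDual ℝ E)}
    (hS : ∀ g, g ∈ closure (Submodule.span ℝ S : Set (StrongDual ℝ E))) :
    dens E ≤ max Cardinal.aleph0 (Cardinal.mk S) := by
  obtain ⟨P, hPc, hP⟩ := exists_subset_closure_span S
  have hx : ∀ φ : StrongDual ℝ E, ∃ x, φ ≠ 0 → ‖φ‖ / 2 * ‖x‖ < ‖φ x‖ := fun φ => by
    by_cases hφ : φ = 0
    · exact ⟨0, fun h => absurd hφ h⟩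
    · by_contra! hcon
      have h1 := φ.opNorm_le_bound (by positivity) fun w => (hcon w).2
      have h2 : 0 < ‖φ‖ := norm_pos_iff.2 hφ
      linarith
  choose x hx using hx
  obtain ⟨D, hDc, hD⟩ := exists_subset_closure_span (x '' P)
  have hle : Cardinal.mk D ≤ max Cardinal.aleph0 (Cardinal.mk S) :=
    hDc.trans (max_le (le_max_left _ _) (Cardinal.mk_image_le.trans hPc))
  suffices hd : Dense D from (csInf_le' ⟨D, hd, rfl⟩ : dens E ≤ Cardinal.mk D).trans hle
  rw [dense_iff_closure_eq, eq_univ_iff_forall]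
  intro y
  refine closure_minimal hD isClosed_closure ?_
  rw [← Submodule.topologicalClosure_coe]
  by_contra hy
  obtain ⟨g, hg0, hg⟩ := exists_functional_vanishing (Submodule.isClosed_topologicalClosure _) hy
  have hgn : 0 < ‖g‖ := norm_pos_iff.2 hg0
  obtain ⟨φ, hφP, hφ⟩ := Metric.mem_closure_iff.1 (closure_minimal hP isClosed_closure (hS g))
    (‖g‖ / 4) (by positivity)
  rw [dist_eq_norm] at hφ
  have h1 : ‖g‖ ≤ ‖g - φ‖ + ‖φ‖ := by simpa using norm_add_le (g - φ) φ
  have hφ0 : φ ≠ 0 := by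
    rintro rfl
    simp at hφ
    linarith
  have h2 := hx φ hφ0
  have h3 : g (x φ) = 0 := hg _ (Submodule.le_topologicalClosure _
    (Submodule.subset_span (mem_image_of_mem x hφP)))
  have h4 : ‖φ (x φ)‖ ≤ ‖g‖ / 4 * ‖x φ‖ := by
    have := (g - φ).le_of_opNorm_le hφ.le (x φ)
    rwa [sub_apply, h3, zero_sub, norm_neg] at this
  nlinarith [norm_nonneg (x φ)]

theorem finiteDimensional_of_closure_span_dual {S : Set (StrongDual ℝ E)} (hfin : S.Finite)
    (hS : ∀ g, g ∈ closure (Submodule.span ℝ S : Set (StrongDual ℝ E))) :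
    FiniteDimensional ℝ E := by
  have : FiniteDimensional ℝ (Submodule.span ℝ S) := FiniteDimensional.span_of_finite ℝ hfin
  have : Finite S := hfin
  have hS' : ∀ g, g ∈ Submodule.span ℝ S := fun g => by
    have := hS g
    rwa [(Submodule.closed_of_finiteDimensional (Submodule.span ℝ S)).closure_eq] at this
  let F : E →ₗ[ℝ] (S → ℝ) := LinearMap.pi fun f => (f.1 : E →ₗ[ℝ] ℝ)
  refine FiniteDimensional.of_injective F (LinearMap.ker_eq_bot.1 ?_)
  refine (Submodule.eq_bot_iff _).2 fun x hx => ?_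
  have hz : ∀ f ∈ S, f x = 0 := fun f hf => congrFun (LinearMap.mem_ker.1 hx) ⟨f, hf⟩
  obtain ⟨g, -, hg⟩ := exists_dual_vector'' ℝ x
  have : g x = 0 := by
    refine Submodule.span_induction (p := fun g _ => g x = 0) hz (by simp) ?_ ?_ (hS' g)
    · intro f f' _ _ h1 h2
      simp [h1, h2]
    · intro c f _ h1
      simp [h1]
  rw [this] at hg
  exact norm_eq_zero.1 hg.symm

end Density

/-! ### True faces as linear points, and the cardinality of the boundary -/

section Faces
variable {E : Type u} [NormedAddCommGroup E] [NormedSpace ℝ E]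

theorem mem_faceInterior_iff {f : StrongDual ℝ E} {x : E} :
    x ∈ faceInterior f ↔ f x = 1 ∧ ∀ᶠ y in 𝓝 x, f y = 1 → ‖y‖ ≤ 1 := by
  have key : ∀ h : f x = 1, (⟨x, h⟩ : hyperplane f) ∈
      interior (((↑) : hyperplane f → E) ⁻¹' face f) ↔ ∀ᶠ y in 𝓝 x, f y = 1 → ‖y‖ ≤ 1 := fun h => by
    rw [mem_interior_iff_mem_nhds, preimage_coe_mem_nhds_subtype, ← eventually_mem_set,
      eventually_nhdsWithin_iff]
    refine eventually_congr (Eventually.of_forall fun y => ?_)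
    simp only [face, mem_inter_iff, mem_closedBall_zero_iff]
    exact ⟨fun H hy => (H hy).2, fun H hy => ⟨hy, H hy⟩⟩
  constructor
  · rintro ⟨⟨y, hy⟩, hyi, rfl⟩
    exact ⟨hy, (key hy).1 hyi⟩
  · rintro ⟨h1, h2⟩
    exact ⟨⟨x, h1⟩, (key h1).2 h2, rfl⟩

/-- The radial projection `y ↦ (f y)⁻¹ • y` carries a neighbourhood of `x` into the hyperplane. -/
theorem mem_faceInterior_iff_isLinearPoint {f : StrongDual ℝ E} (hf : ∀ y, f y ≤ ‖y‖) {x : E} :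
    x ∈ faceInterior f ↔ f x = 1 ∧ IsLinearPoint f x := by
  rw [mem_faceInterior_iff]
  refine and_congr_right fun hx => ⟨fun h => ?_, fun h => ?_⟩
  · have hx0 : f x ≠ 0 := by rw [hx]; exact one_ne_zero
    have hc : Tendsto (fun y => (f y)⁻¹ • y) (𝓝 x) (𝓝 x) := by
      have := (f.continuous.tendsto x).inv₀ hx0 |>.smul (tendsto_id (x := 𝓝 x))
      simpa [hx] using this
    have hpos : ∀ᶠ y in 𝓝 x, 0 < f y :=
      f.continuous.continuousAt.eventually (lt_mem_nhds (by rw [hx]; exact one_pos))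
    filter_upwards [hc.eventually h, hpos] with y hy hy0
    refine le_antisymm ?_ (hf y)
    have h1 := hy (by rw [map_smul, smul_eq_mul, inv_mul_cancel₀ hy0.ne'])
    rwa [norm_smul, norm_inv, Real.norm_of_nonneg hy0.le, inv_mul_le_one₀ hy0] at h1
  · filter_upwards [h] with y hy h1
    rw [hy, h1]

theorem eq_of_mem_faceInterior {f g : StrongDual ℝ E} (hf : ∀ y, f y ≤ ‖y‖) (hg : ∀ y, g y ≤ ‖y‖)
    {x : E} (hxf : x ∈ faceInterior f) (hxg : x ∈ faceInterior g) : f = g := by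
  obtain ⟨-, h1⟩ := (mem_faceInterior_iff_isLinearPoint hf).1 hxf
  obtain ⟨-, h2⟩ := (mem_faceInterior_iff_isLinearPoint hg).1 hxg
  exact h2.eq_of_norming hf h1.norm_eq.symm

theorem norm_of_mem_face {f : StrongDual ℝ E} (hf : ∀ y, f y ≤ ‖y‖) {x : E} (hx : x ∈ face f) :
    ‖x‖ = 1 :=
  le_antisymm (mem_closedBall_zero_iff.1 hx.2) ((show f x = 1 from hx.1) ▸ hf x)

/-- `IsTrueFace` only provides some functional cutting out the same face; a linear point of that
face forces it to be `f`. -/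
theorem mem_minimalBoundary_iff {f : StrongDual ℝ E} :
    f ∈ minimalBoundary E ↔ ‖f‖ = 1 ∧ (faceInterior f).Nonempty := by
  refine and_congr_right fun hf => ⟨?_, fun h => ⟨f, hf, rfl, h⟩⟩
  rintro ⟨g, hg, hfg, x, hx⟩
  obtain ⟨hx1, hxl⟩ := (mem_faceInterior_iff_isLinearPoint (apply_le_norm hg.le)).1 hx
  have hxn : ‖x‖ = 1 := by rw [hxl.norm_eq, hx1]
  have hxf : x ∈ face f := by rw [hfg]; exact ⟨hx1, by simp [hxn]⟩
  have : f = g := hxl.eq_of_norming (apply_le_norm hf.le) (by rw [hxn]; exact hxf.1)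
  exact ⟨x, this ▸ hx⟩

theorem apply_le_norm_of_mem_minimalBoundary {f : StrongDual ℝ E} (hf : f ∈ minimalBoundary E)
    (y : E) : f y ≤ ‖y‖ := apply_le_norm hf.1.le y

theorem IsLinearPoint.smul {f : StrongDual ℝ E} {x : E} (h : IsLinearPoint f x) {c : ℝ}
    (hc : 0 < c) : IsLinearPoint f (c • x) := by
  have ht : Tendsto (fun y : E => c⁻¹ • y) (𝓝 (c • x)) (𝓝 x) := by
    have := (continuous_const_smul c⁻¹).tendsto (c • x)
    rwa [smul_smul, inv_mul_cancel₀ hc.ne', one_smul] at this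
  filter_upwards [ht.eventually h] with y hy
  rw [norm_smul, map_smul, smul_eq_mul, Real.norm_of_nonneg (by positivity)] at hy
  exact mul_left_cancel₀ (inv_ne_zero hc.ne') hy

theorem IsLinearPoint.mem_minimalBoundary {f : StrongDual ℝ E} (hf : ∀ y, f y ≤ ‖y‖) {x : E}
    (hx : x ≠ 0) (h : IsLinearPoint f x) : f ∈ minimalBoundary E := by
  have hn : 0 < ‖x‖ := norm_pos_iff.2 hx
  refine mem_minimalBoundary_iff.2 ⟨le_antisymm ?_ ?_, ‖x‖⁻¹ • x, ?_⟩
  · refine f.opNorm_le_bound zero_le_one fun y => ?_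
    have h2 := hf (-y)
    rw [map_neg, norm_neg] at h2
    rw [one_mul]
    exact abs_le.2 ⟨by linarith, hf y⟩
  · have := f.le_opNorm x
    rw [← h.norm_eq, norm_norm] at this
    exact le_of_mul_le_mul_right (by linarith) hn
  · refine (mem_faceInterior_iff_isLinearPoint hf).2 ⟨?_, h.smul (by positivity)⟩
    rw [map_smul, smul_eq_mul, ← h.norm_eq, inv_mul_cancel₀ hn.ne']

theorem exists_mem_minimalBoundary_norming [CompleteSpace E] (hE : RadiallyAffine E) {x : E}
    (hx : x ≠ 0) : ∃ f ∈ minimalBoundary E, f x = ‖x‖ := by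
  obtain ⟨z, f, hz, hf, hl, hfx⟩ := exists_linearPoint_norming hE x (norm_pos_iff.2 hx)
  refine ⟨f, hl.mem_minimalBoundary hf ?_, hfx⟩
  rintro rfl
  simp at hz

/-- The linear points of distinct functionals form disjoint nonempty open sets, and a dense set
meets each of them. -/
theorem mk_minimalBoundary_le_dens : Cardinal.mk (minimalBoundary E) ≤ dens E := by
  refine le_csInf ⟨_, univ, dense_univ, rfl⟩ ?_
  rintro _ ⟨D, hD, rfl⟩
  have hex : ∀ f : minimalBoundary E, ∃ d : D, IsLinearPoint f.1 (d : E) := fun f => by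
    obtain ⟨x, hx⟩ := (mem_minimalBoundary_iff.1 f.2).2
    have hl := ((mem_faceInterior_iff_isLinearPoint
      (apply_le_norm_of_mem_minimalBoundary f.2)).1 hx).2
    obtain ⟨U, hUs, hU, hxU⟩ := eventually_nhds_iff.1 hl.eventually
    obtain ⟨d, hdU, hd⟩ := hD.inter_open_nonempty U hU ⟨x, hxU⟩
    exact ⟨⟨d, hd⟩, hUs d hdU⟩
  choose d hd using hex
  refine Cardinal.mk_le_of_injective (f := d) fun f g hfg => Subtype.ext ?_
  have h1 := hd f
  rw [hfg] at h1
  exact (hd g).eq_of_norming (apply_le_norm_of_mem_minimalBoundary f.2) h1.norm_eq.symm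

theorem mk_minimalBoundary_eq_dens [CompleteSpace E] (hinf : ¬ FiniteDimensional ℝ E)
    (hE : RadiallyAffine E) : Cardinal.mk (minimalBoundary E) = dens E := by
  refine le_antisymm mk_minimalBoundary_le_dens ?_
  -- With `h = 0` and `a = -1` the slice is the whole sphere.
  have hcl := mem_closure_span_of_norming hE 0 (a := -1) (x₀ := 0) (by simp) (by simp)
    (minimalBoundary E) (fun f hf => apply_le_norm_of_mem_minimalBoundary hf) fun y hy _ => by
      obtain ⟨f, hf, hfy⟩ := exists_mem_minimalBoundary_norming hE (x := y) (by
        rintro rfl; simp at hy)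
      exact ⟨f, hf, hfy.trans hy⟩
  have hB : Cardinal.aleph0 ≤ Cardinal.mk (minimalBoundary E) := by
    rw [← Cardinal.infinite_iff, Set.infinite_coe_iff]
    exact fun hfin => hinf (finiteDimensional_of_closure_span_dual (hfin.insert 0) hcl)
  refine (dens_le_of_closure_span_dual hcl).trans (max_le hB ?_)
  exact Cardinal.mk_insert_le.trans (Cardinal.add_one_eq hB).le

end Faces

/-! ### The ball as closed hull of the remaining faces, and approximation from face interiors -/

section Main
variable {E : Type u} [NormedAddCommGroup E] [NormedSpace ℝ E]

/-- A functional separating a point of the ball from the hull defines a slice avoiding all faces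
outside `C`, so the few functionals indexed by `C` norm it; the dual is then too small. -/
theorem closedBall_eq_closure_convexHull_faces [CompleteSpace E]
    (hinf : ¬ FiniteDimensional ℝ E) (hE : RadiallyAffine E) {ι : Type v}
    {fp fm : ι → StrongDual ℝ E} (hunion : range fp ∪ range fm = minimalBoundary E) {C : Set ι}
    (hC : Cardinal.lift.{u} (Cardinal.mk C) < Cardinal.lift.{v} (Cardinal.mk (minimalBoundary E))) :
    Metric.closedBall (0 : E) 1
      = closure (convexHull ℝ (⋃ w ∈ Cᶜ, (face (fp w) ∪ face (fm w)))) := by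
  have hp : ∀ w, fp w ∈ minimalBoundary E := fun w => hunion ▸ Or.inl (mem_range_self w)
  have hm : ∀ w, fm w ∈ minimalBoundary E := fun w => hunion ▸ Or.inr (mem_range_self w)
  set U := ⋃ w ∈ Cᶜ, (face (fp w) ∪ face (fm w)) with hU
  refine Subset.antisymm (fun z hz => ?_) (closure_minimal (convexHull_min ?_
    (convex_closedBall 0 1)) Metric.isClosed_closedBall)
  swap
  · exact iUnion₂_subset fun w _ => union_subset inter_subset_right inter_subset_right
  by_contra hzU
  obtain ⟨h, a, hha, haz⟩ := geometric_hahn_banach_closed_point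
    (convex_convexHull ℝ U).closure isClosed_closure hzU
  have hUa : ∀ y ∈ U, h y < a := fun y hy => hha y (subset_closure (subset_convexHull ℝ U hy))
  obtain ⟨x₀, hx₀, hx₀a⟩ : ∃ x₀ : E, ‖x₀‖ < 1 ∧ a < h x₀ := by
    have hc : ∀ᶠ t : ℝ in 𝓝[<] 1, a < h (t • z) := by
      have hcont : Continuous fun t : ℝ => h (t • z) := by fun_prop
      refine (hcont.continuousAt.eventually (lt_mem_nhds ?_)).filter_mono nhdsWithin_le_nhds
      simpa using haz
    have hpos : ∀ᶠ t : ℝ in 𝓝[<] 1, 0 < t :=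
      (lt_mem_nhds zero_lt_one : ∀ᶠ t : ℝ in 𝓝 1, 0 < t).filter_mono nhdsWithin_le_nhds
    obtain ⟨t, ⟨ht, ht0⟩, ht1⟩ := ((hc.and hpos).and self_mem_nhdsWithin).exists
    refine ⟨t • z, ?_, ht⟩
    rw [norm_smul, Real.norm_of_nonneg ht0.le]
    exact (mul_le_of_le_one_right ht0.le (mem_closedBall_zero_iff.1 hz)).trans_lt ht1
  have hcl := mem_closure_span_of_norming hE h hx₀ hx₀a (fp '' C ∪ fm '' C)
    (by
      rintro f (⟨w, -, rfl⟩ | ⟨w, -, rfl⟩)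
      exacts [apply_le_norm_of_mem_minimalBoundary (hp w),
        apply_le_norm_of_mem_minimalBoundary (hm w)])
    fun y hy hya => by
      obtain ⟨f, hf, hfy⟩ := exists_mem_minimalBoundary_norming hE (x := y) (by
        rintro rfl; simp at hy)
      rw [hy] at hfy
      refine ⟨f, ?_, hfy⟩
      have hyf : y ∈ face f := ⟨hfy, by simp [hy]⟩
      rw [← hunion] at hf
      have hC' : ∀ w, y ∈ face (fp w) ∪ face (fm w) → w ∈ C := fun w hw => by
        by_contra hwC
        exact (hUa y (mem_iUnion₂.2 ⟨w, hwC, hw⟩)).not_gt hya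
      rcases hf with ⟨w, rfl⟩ | ⟨w, rfl⟩
      · exact Or.inl (mem_image_of_mem _ (hC' w (Or.inl hyf)))
      · exact Or.inr (mem_image_of_mem _ (hC' w (Or.inr hyf)))
  -- A finite `C` would make `E` finite-dimensional; for infinite `C`, doubling and adding `h` do
  -- not change the cardinality.
  rcases C.finite_or_infinite with hfin | hCinf
  · exact hinf (finiteDimensional_of_closure_span_dual
      (((hfin.image fp).union (hfin.image fm)).insert h) hcl)
  have hCinf' : Cardinal.aleph0 ≤ Cardinal.lift.{u} (Cardinal.mk C) := by
    rw [Cardinal.aleph0_le_lift, ← Cardinal.infinite_iff]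
    exact hCinf.to_subtype
  have hle : Cardinal.lift.{v} (Cardinal.mk (insert h (fp '' C ∪ fm '' C) : Set (StrongDual ℝ E)))
      ≤ Cardinal.lift.{u} (Cardinal.mk C) := by
    have h1 := Cardinal.lift_le.{v}.2 ((Cardinal.mk_insert_le (a := h)
      (s := fp '' C ∪ fm '' C)).trans (add_le_add_left (Cardinal.mk_union_le _ _) 1))
    rw [Cardinal.lift_add, Cardinal.lift_add, Cardinal.lift_one] at h1
    refine h1.trans ((add_le_add_left (add_le_add Cardinal.mk_image_le_lift
      Cardinal.mk_image_le_lift) 1).trans ?_)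
    rw [Cardinal.add_eq_self hCinf', Cardinal.add_one_eq hCinf']
  have hdens := Cardinal.lift_le.{v}.2 (dens_le_of_closure_span_dual hcl)
  rw [Cardinal.lift_max, Cardinal.lift_aleph0, ← mk_minimalBoundary_eq_dens hinf hE] at hdens
  exact (hdens.trans (max_le hCinf' hle)).not_gt hC

/-- Points of the convex hull of faces are sums of vectors from the cones over the faces. -/
theorem exists_finsupp_of_mem_convexHull_faces {J : Type v} {F : J → StrongDual ℝ E}
    (hF : ∀ j y, F j y ≤ ‖y‖) {N : Set J} {q : E} (hq : q ∈ convexHull ℝ (⋃ j ∈ N, face (F j))) :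
    ∃ c : J →₀ E, (∀ j, F j (c j) = ‖c j‖) ∧ (∀ j, j ∉ N → c j = 0) ∧
      ∑ j ∈ c.support, ‖c j‖ = 1 ∧ ∑ j ∈ c.support, c j = q := by
  let Λ : (J →₀ E) →ₗ[ℝ] ℝ := Finsupp.lsum ℝ fun j => (F j : E →ₗ[ℝ] ℝ)
  let S : (J →₀ E) →ₗ[ℝ] E := Finsupp.lsum ℝ fun _ => LinearMap.id
  -- Convex because each cone `{y | F j y = ‖y‖}` is convex. Indexing by faces merges all points of
  -- one face into a single vector.
  let K : Set (J →₀ E) := {c | (∀ j, F j (c j) = ‖c j‖) ∧ (∀ j, j ∉ N → c j = 0) ∧ Λ c = 1}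
  have hK : Convex ℝ K := by
    rintro c ⟨h1, h2, h3⟩ d ⟨k1, k2, k3⟩ a b ha hb hab
    refine ⟨fun j => le_antisymm (hF _ _) ?_, fun j hj => ?_, ?_⟩
    · rw [Finsupp.add_apply, Finsupp.smul_apply, Finsupp.smul_apply, map_add, map_smul, map_smul,
        h1, k1]
      refine (norm_add_le _ _).trans_eq ?_
      rw [norm_smul, norm_smul, Real.norm_of_nonneg ha, Real.norm_of_nonneg hb]
      rfl
    · rw [Finsupp.add_apply, Finsupp.smul_apply, Finsupp.smul_apply, h2 j hj, k2 j hj]; simp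
    · rw [map_add, map_smul, map_smul, h3, k3]; simpa using hab
  have hsub : (⋃ j ∈ N, face (F j)) ⊆ S '' K := by
    refine iUnion₂_subset fun j hj x hx => ⟨Finsupp.single j x, ⟨fun i => ?_, fun i hi => ?_, ?_⟩,
      by simp [S]⟩
    · classical
      rcases eq_or_ne j i with rfl | hne
      · rw [Finsupp.single_eq_same, norm_of_mem_face (hF j) hx]; exact hx.1
      · simp [Finsupp.single_eq_of_ne' hne]
    · exact Finsupp.single_eq_of_ne (by rintro rfl; exact hi hj)
    · simpa [Λ] using (show F j x = 1 from hx.1)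
  obtain ⟨c, ⟨h1, h2, h3⟩, rfl⟩ := convexHull_min hsub (hK.linear_image S) hq
  refine ⟨c, h1, h2, ?_, by simp [S, Finsupp.sum]⟩
  rw [← h3]
  simp only [Λ, Finsupp.lsum_apply, Finsupp.sum]
  exact Finset.sum_congr rfl fun j _ => (h1 j).symm

/-- Moving finitely supported cone vectors into the interiors of the faces. -/
theorem exists_faceInterior_points {J : Type v} {F : J → StrongDual ℝ E}
    (hF : ∀ j, F j ∈ minimalBoundary E) {c : J →₀ E} (hc : ∀ j, F j (c j) = ‖c j‖)
    (hsum : ∑ j ∈ c.support, ‖c j‖ = 1) {ε : ℝ} (hε : 0 < ε) :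
    ∃ p : J → E, (∀ j, p j ∈ faceInterior (F j)) ∧
      ‖∑ j ∈ c.support, c j - ∑ j ∈ c.support, ‖c j‖ • p j‖ ≤ ε := by
  have hle : ∀ j y, F j y ≤ ‖y‖ := fun j => apply_le_norm_of_mem_minimalBoundary (hF j)
  have hp : ∀ j, ∃ p ∈ faceInterior (F j), ‖c j - ‖c j‖ • p‖ ≤ ε * ‖c j‖ := fun j => by
    obtain ⟨u, hu⟩ := (mem_minimalBoundary_iff.1 (hF j)).2
    rcases eq_or_ne (c j) 0 with h0 | h0
    · exact ⟨u, hu, by simp [h0]⟩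
    have hn : 0 < ‖c j‖ := norm_pos_iff.2 h0
    obtain ⟨hu1, hul⟩ := (mem_faceInterior_iff_isLinearPoint (hle j)).1 hu
    have hun : ‖u‖ = 1 := hul.norm_eq.trans hu1
    -- Moving by `τ` towards the interior point `u` shifts a unit vector by at most `2 * τ ≤ ε`.
    set τ := min 1 (ε / 2) with hτ
    have hτ0 : 0 < τ := lt_min one_pos (half_pos hε)
    set x := ‖c j‖⁻¹ • c j with hx
    have hcx : c j = ‖c j‖ • x := by rw [hx, smul_smul, mul_inv_cancel₀ hn.ne', one_smul]
    have hxn : ‖x‖ = 1 := by rw [hx, norm_smul, norm_inv, norm_norm, inv_mul_cancel₀ hn.ne']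
    have hx1 : F j x = 1 := by rw [hx, map_smul, hc, smul_eq_mul, inv_mul_cancel₀ hn.ne']
    refine ⟨(1 - τ) • x + τ • u, (mem_faceInterior_iff_isLinearPoint (hle j)).2 ⟨?_,
      hul.combo (hle j) (hx1.trans hxn.symm) hτ0 (min_le_left _ _)⟩, ?_⟩
    · simp [hx1, hu1]
    · have e : c j - ‖c j‖ • ((1 - τ) • x + τ • u) = (τ * ‖c j‖) • (x - u) := by
        nth_rewrite 1 [hcx]
        module
      rw [e, norm_smul, Real.norm_of_nonneg (by positivity)]
      have h1 : ‖x - u‖ ≤ 2 := (norm_sub_le _ _).trans (by rw [hxn, hun]; norm_num)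
      have h2 : τ ≤ ε / 2 := min_le_right _ _
      calc τ * ‖c j‖ * ‖x - u‖ ≤ ε / 2 * ‖c j‖ * 2 := by gcongr
        _ = ε * ‖c j‖ := by ring
  choose p hp1 hp2 using hp
  refine ⟨p, hp1, ?_⟩
  rw [← Finset.sum_sub_distrib]
  calc _ ≤ ∑ j ∈ c.support, ε * ‖c j‖ := norm_sum_le_of_le _ fun j _ => hp2 j
    _ = ε := by rw [← Finset.mul_sum, hsum, mul_one]

end Main
end PolyhedralSpace

theorem lemma3p1 {E : Type u} [NormedAddCommGroup E] [NormedSpace ℝ E] [CompleteSpace E]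
    (hinf : ¬ FiniteDimensional ℝ E) (hE : IsPolyhedral E)
    {ι : Type v} (fp fm : ι → StrongDual ℝ E)
    (hfp : Function.Injective fp) (hfm : Function.Injective fm)
    (hneg : ∀ w, fp w = -fm w)
    (hdisj : Disjoint (Set.range fp) (Set.range fm))
    (hunion : Set.range fp ∪ Set.range fm = minimalBoundary E) :
    Cardinal.mk (minimalBoundary E) = dens E ∧
    ∀ C : Set ι,
      Cardinal.lift.{u} (Cardinal.mk C) < Cardinal.lift.{v} (Cardinal.mk (minimalBoundary E)) →
      Metric.closedBall (0 : E) 1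
          = closure (convexHull ℝ (⋃ w ∈ Cᶜ, (face (fp w) ∪ face (fm w)))) ∧
      ∀ z ∈ Metric.closedBall (0 : E) 1, ∀ θ : ℝ, 0 < θ →
        ∃ (A : Finset ι) (G : Finset E), A.Nonempty ∧ (A : Set ι) ⊆ Cᶜ ∧ G.Nonempty ∧
          (G : Set E) ⊆ ⋃ w ∈ A, (faceInterior (fp w) ∪ faceInterior (fm w)) ∧
          z ∈ convexHull ℝ (G : Set E) + θ • Metric.closedBall (0 : E) 1 ∧
          ∀ w ∈ A, (∃ x, (G : Set E) ∩ faceInterior (fp w) = {x}) ∧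
            (∃ y, (G : Set E) ∩ faceInterior (fm w) = {y}) := by
  have hR := hE.radiallyAffine
  refine ⟨mk_minimalBoundary_eq_dens hinf hR, fun C hC => ?_⟩
  have hball := closedBall_eq_closure_convexHull_faces hinf hR hunion hC
  refine ⟨hball, fun z hz θ hθ => ?_⟩
  classical
  let F : ι ⊕ ι → StrongDual ℝ E := Sum.elim fp fm
  have hFinj : Function.Injective F := hfp.sumElim hfm fun a b h =>
    Set.disjoint_left.1 hdisj (Set.mem_range_self a) (h ▸ Set.mem_range_self b)
  have hFB : ∀ j, F j ∈ minimalBoundary E := by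
    rw [← hunion]
    rintro (w | w)
    exacts [Or.inl (Set.mem_range_self w), Or.inr (Set.mem_range_self w)]
  have hFle : ∀ j y, F j y ≤ ‖y‖ := fun j => apply_le_norm_of_mem_minimalBoundary (hFB j)
  let idx : ι ⊕ ι → ι := Sum.elim id id
  have hfaces : (⋃ w ∈ Cᶜ, (face (fp w) ∪ face (fm w))) = ⋃ j ∈ {j | idx j ∉ C}, face (F j) := by
    ext x
    simp only [Set.mem_iUnion, Set.mem_union, exists_prop, Sum.exists, F, idx, Sum.elim_inl,
      Sum.elim_inr, Set.mem_compl_iff, Set.mem_ofPred_eq, id, and_or_left, exists_or]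
  rw [hball, hfaces] at hz
  obtain ⟨q, hq, hzq⟩ := Metric.mem_closure_iff.1 hz (θ / 2) (half_pos hθ)
  obtain ⟨c, hc, hcC, hc1, rfl⟩ := exists_finsupp_of_mem_convexHull_faces hFle hq
  obtain ⟨p, hp, hpc⟩ := exists_faceInterior_points hFB hc hc1 (half_pos hθ)
  -- Interiors of different true faces are disjoint, which will make the intersections with `G`
  -- singletons.
  have hpF : ∀ i j, p i ∈ faceInterior (F j) → i = j := fun i j h =>
    hFinj (eq_of_mem_faceInterior (hFle i) (hFle j) (hp i) h)
  have hne : c.support.Nonempty := by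
    by_contra h
    rw [Finset.not_nonempty_iff_eq_empty.1 h] at hc1
    simp at hc1
  let A : Finset ι := c.support.image idx
  -- Both signs are included for every index in `A`, even if only one of them carries weight;
  -- enlarging `G` only enlarges the hull.
  let G : Finset E := A.image (fun w => p (Sum.inl w)) ∪ A.image (fun w => p (Sum.inr w))
  have hG : ∀ j, p j ∈ G ↔ idx j ∈ A := by
    have hinj : ∀ i j, p i = p j ↔ i = j := fun i j =>
      ⟨fun h => hpF i j (h ▸ hp j), fun h => by rw [h]⟩
    rintro (w | w) <;> simp [G, hinj, idx]
  have hGp : ∀ y ∈ G, ∃ j, p j = y := fun y hy => by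
    rcases Finset.mem_union.1 hy with h | h <;> obtain ⟨w, -, rfl⟩ := Finset.mem_image.1 h
    exacts [⟨_, rfl⟩, ⟨_, rfl⟩]
  have hsupp : ∀ j ∈ c.support, p j ∈ G := fun j hj => (hG j).2 (Finset.mem_image_of_mem idx hj)
  have hsing : ∀ j, idx j ∈ A → (G : Set E) ∩ faceInterior (F j) = {p j} := fun j hj => by
    ext y
    constructor
    · rintro ⟨hyG, hyF⟩
      obtain ⟨i, rfl⟩ := hGp y hyG
      rw [hpF i j hyF]
      rfl
    · rintro rfl
      exact ⟨(hG j).2 hj, hp j⟩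
  refine ⟨A, G, hne.image _, ?_, ?_, ?_, ?_, fun w hw =>
    ⟨⟨_, hsing (Sum.inl w) hw⟩, ⟨_, hsing (Sum.inr w) hw⟩⟩⟩
  · intro w hw
    obtain ⟨j, hj, rfl⟩ := Finset.mem_image.1 (Finset.mem_coe.1 hw)
    exact fun hjC => Finsupp.mem_support_iff.1 hj (hcC j fun h => h hjC)
  · obtain ⟨j, hj⟩ := hne
    exact ⟨p j, hsupp j hj⟩
  · intro y hy
    obtain ⟨j, rfl⟩ := hGp y hy
    refine Set.mem_iUnion₂.2 ⟨idx j, (hG j).1 hy, ?_⟩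
    rcases j with w | w
    exacts [Or.inl (hp (Sum.inl w)), Or.inr (hp (Sum.inr w))]
  · set q' := ∑ j ∈ c.support, ‖c j‖ • p j with hq'
    have hmem : q' ∈ convexHull ℝ (G : Set E) := (convex_convexHull ℝ _).sum_mem
      (fun j _ => norm_nonneg _) hc1 fun j hj => subset_convexHull ℝ _ (hsupp j hj)
    refine Set.mem_add.2 ⟨q', hmem, z - q', ?_, add_sub_cancel _ _⟩
    rw [smul_unitClosedBall, Real.norm_of_nonneg hθ.le, mem_closedBall_zero_iff]
    rw [dist_eq_norm] at hzq
    have := norm_sub_le_norm_sub_add_norm_sub z (∑ j ∈ c.support, c j) q'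
    linarith
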